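/- All graphs are finite and simple; $|G|$ and $\|G\|$ denote the numbers of vertices and edges of $G$. A class $\mathcal C$ of graphs has \emph{bounded expansion} if there is a function $f:\mathbb N\to\mathbb R$ such that $\|H\|/|H|\le f(d)$ for every $d\in\mathbb N$ and every non-null shallow minor $H$ at depth $d$ of a graph in $\mathcal C$; here $H$ is a \emph{shallow minor of $G$ at depth $d$} if $H$ is a subgraph of the simple graph obtained from $G$ by contracting each connected component of some subgraph of $G$, all of whose components have radius at most $d$, to a single vertex. For $r\in\mathbb N$ let $$\widetilde\nabla_r(G)=\sup_X \frac{\|X\|}{|X|},$$ where $X$ ranges over the non-null shallow topological minors of $G$ at depth $r$, that is, the graphs $X$ such that some subgraph of $G$ is a $(\le 2r)$-subdivision of $X$ (each edge of $X$ is replaced by a path with at most $2r$ inner vertices). The supremum over the empty set is taken to be $0$. A graph $G$ is a \emph{$k$-stack graph} if its vertices can be linearly ordered and its edges partitioned into $k$ (possibly empty) sets such that no two edges $ab$ and $cd$ in the same set satisfy $a<c<b<d$ in this order; the \emph{stack-number} (book thickness) of $G$ is the minimum such $k$. \textbf{Theorem.} Every class of graphs with bounded stack-number has bounded expansion. Moreover,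 for every integer $k\ge 3$, every $k$-stack graph $G$ and every integer $r\ge 0$, $$\widetilde\nabla_r(G)\le\frac{4k(5k-5)^{2r+1}}{5k-6}.$$ -/

import Mathlib

universe u v

namespace StackExpansion

/-! ### Finite simple graphs and graph classes -/

/-- A finite simple graph. A class of graphs is a `Set FinGraph`. -/
structure FinGraph : Type (u + 1) where
  V : Type u
  [finite : Finite V]
  graph : SimpleGraph V

attribute [instance] FinGraph.finite

/-- The ratio of the number of edges to the number of vertices (`0` for the null graph). -/
noncomputable def FinGraph.density (G : FinGraph.{u}) : ℝ :=
  (G.graph.edgeSet.ncard : ℝ) / (Nat.card G.V : ℝ)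

/-! ### Shallow minors and bounded expansion -/

/-- The simple graph obtained from `G` by contracting every connected component of the spanning
graph `X` to a single vertex. -/
def contraction {V : Type u} (G X : SimpleGraph V) : SimpleGraph X.ConnectedComponent where
  Adj c c' := c ≠ c' ∧ ∃ x y : V,
    X.connectedComponentMk x = c ∧ X.connectedComponentMk y = c' ∧ G.Adj x y
  symm := ⟨fun _ _ ⟨hne, x, y, hx, hy, h⟩ => ⟨hne.symm, y, x, hy, hx, h.symm⟩⟩
  loopless := ⟨fun _ h => h.1 rfl⟩

/-- `H` is a shallow minor of `G` at depth `d`: it is (isomorphic to) a subgraph of the graph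
obtained from `G` by contracting the components of a subgraph `X` all of whose components have
radius at most `d`. Vertices of `G` outside the subgraph are isolated vertices of `X` here, that is,
components of radius `0`, whose contraction changes nothing. -/
def IsShallowMinor {V : Type u} {W : Type v} (d : ℕ) (H : SimpleGraph W) (G : SimpleGraph V) :
    Prop :=
  ∃ X : SimpleGraph V, X ≤ G ∧
    (∀ c : X.ConnectedComponent, c.toSimpleGraph.radius ≤ (d : ℕ∞)) ∧
    H.IsContained (contraction G X)

/-- The class of all shallow minors at depth `d` of graphs of the class `C`. -/
def shallowMinors (C : Set FinGraph.{u}) (d : ℕ) : Set FinGraph.{u} :=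
  {H | ∃ G ∈ C, IsShallowMinor d H.graph G.graph}

/-- The greatest reduced average density of rank `d` of a class of graphs. -/
noncomputable def grad (C : Set FinGraph.{u}) (d : ℕ) : EReal :=
  ⨆ H ∈ shallowMinors C d, (H.density : EReal)

/-- A class of graphs has bounded expansion if its greatest reduced average densities are bounded by
a real-valued function of the rank. -/
def HasBoundedExpansion (C : Set FinGraph.{u}) : Prop :=
  ∃ f : ℕ → ℝ, ∀ d : ℕ, grad C d ≤ (f d : EReal)

/-! ### Shallow topological minors -/

/-- `S` is (isomorphic to) a `(≤ t)`-subdivision of `X`: it is obtained from `X` by replacing each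
edge by a path with at most `t` inner vertices. `φ` gives the original vertices and `P` the paths;
the path of an edge is given once for each direction. -/
def IsSubdivision {U : Type u} {W : Type v} (t : ℕ) (S : SimpleGraph U) (X : SimpleGraph W) :
    Prop :=
  ∃ (φ : W ↪ U) (P : ∀ a b : W, X.Adj a b → S.Walk (φ a) (φ b)),
    -- each edge becomes a path with at most `t` inner vertices
    (∀ a b (h : X.Adj a b), (P a b h).IsPath ∧ (P a b h).length ≤ t + 1) ∧
    (∀ a b (h : X.Adj a b), P b a h.symm = (P a b h).reverse) ∧
    -- no original vertex is an inner vertex of a path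
    (∀ a b (h : X.Adj a b) (w : W), φ w ∈ (P a b h).support → w = a ∨ w = b) ∧
    -- paths of different edges have no inner vertex in common
    (∀ a b (h : X.Adj a b) a' b' (h' : X.Adj a' b'), s(a, b) ≠ s(a', b') →
      ∀ x : U, x ∈ (P a b h).support → x ∈ (P a' b' h').support → x ∈ Set.range φ) ∧
    -- `S` has no further vertices and no further edges
    (∀ x : U, x ∈ Set.range φ ∨ ∃ a b, ∃ h : X.Adj a b, x ∈ (P a b h).support) ∧
    (∀ e ∈ S.edgeSet, ∃ a b, ∃ h : X.Adj a b, e ∈ (P a b h).edges)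

/-- `H` is a shallow topological minor of `G` at depth `d`: replacing paths of length at most
`2 * d + 1` by single edges turns some subgraph of `G` into `H`. In other words, some subgraph of
`G` is a `(≤ 2 * d)`-subdivision of `H`. -/
def IsShallowTopologicalMinor {V : Type u} {W : Type v} (d : ℕ) (H : SimpleGraph W)
    (G : SimpleGraph V) : Prop :=
  ∃ S : G.Subgraph, IsSubdivision (2 * d) S.coe H

/-- The class of all shallow topological minors at depth `d` of graphs of the class `C`. -/
def shallowTopologicalMinors (C : Set FinGraph.{u}) (d : ℕ) : Set FinGraph.{u} :=
  {H | ∃ G ∈ C, IsShallowTopologicalMinor d H.graph G.graph}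

/-- The topological greatest reduced average density of rank `d` of a class of graphs. -/
noncomputable def topGrad (C : Set FinGraph.{u}) (d : ℕ) : EReal :=
  ⨆ H ∈ shallowTopologicalMinors C d, (H.density : EReal)

/-! ### Stack layouts -/

/-- In an ordered graph, the edge `e` crosses the edge `f` if `ℓ(e) < ℓ(f) < r(e) < r(f)`, where `ℓ`
and `r` give the left and the right end of an edge. -/
def Crosses {V : Type u} [LinearOrder V] (e f : Sym2 V) : Prop :=
  e.inf < f.inf ∧ f.inf < e.sup ∧ e.sup < f.sup

/-- An ordered graph is a `k`-stack if its edges can be partitioned into `k` (possibly empty) sets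
such that no two edges in the same set cross. -/
def IsKStack {V : Type u} [LinearOrder V] (k : ℕ) (G : SimpleGraph V) : Prop :=
  ∃ page : G.edgeSet → Fin k,
    ∀ e f : G.edgeSet, page e = page f → ¬ Crosses (e : Sym2 V) (f : Sym2 V)

/-- `G` is a `k`-stack graph: it has a `k`-stack layout (a `k`-page book embedding), that is, it is
isomorphic to an ordered graph that is a `k`-stack. -/
def FinGraph.HasStackLayout (G : FinGraph.{u}) (k : ℕ) : Prop :=
  ∃ G' : SimpleGraph (Fin (Nat.card G.V)), IsKStack k G' ∧ Nonempty (G.graph ≃g G')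

/-- The stack-number (book thickness) of a graph. -/
noncomputable def FinGraph.stackNumber (G : FinGraph.{u}) : ℕ :=
  sInf {k : ℕ | G.HasStackLayout k}

/-- Every finite graph has a stack layout, so the stack-number is a minimum. -/
theorem FinGraph.exists_hasStackLayout (G : FinGraph.{u}) : ∃ k : ℕ, G.HasStackLayout k := by
  classical
  let σ := Finite.equivFin G.V
  let G' := G.graph.map σ.toEmbedding
  let p := Finite.equivFin G'.edgeSet
  refine ⟨Nat.card G'.edgeSet, G', ⟨p, fun e f h => ?_⟩, ⟨SimpleGraph.Iso.map σ G.graph⟩⟩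
  rw [p.injective h]
  exact fun hc => lt_irrefl _ hc.1

theorem FinGraph.HasStackLayout.mono {G : FinGraph.{u}} {k l : ℕ} (h : G.HasStackLayout k)
    (hkl : k ≤ l) : G.HasStackLayout l := by
  obtain ⟨G', ⟨p, hp⟩, i⟩ := h
  exact ⟨G', ⟨fun e => Fin.castLE hkl (p e), fun e f hef =>
    hp e f (Fin.castLE_injective hkl hef)⟩, i⟩

theorem FinGraph.stackNumber_le_iff (G : FinGraph.{u}) (k : ℕ) :
    G.stackNumber ≤ k ↔ G.HasStackLayout k :=
  ⟨fun h => (Nat.sInf_mem (s := {k : ℕ | G.HasStackLayout k}) G.exists_hasStackLayout).mono h,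
    fun h => Nat.sInf_le h⟩

end StackExpansion

namespace StackExpansion

/-! A shallow minor `H` at depth `d` gives disjoint vertex sets of `G`, one per vertex of `H`, whose
elements are reached from a root within `d` steps inside the set. So does a `(≤ 2d)`-subdivision,
once every path is cut in the middle. The point is that these sets have a description in the vertex
order whose size is linear in `|H|`.

The description uses cuts of the order into intervals labelled by owners. Non-crossing edges between
the intervals of two cuts realise only linearly many pairs of intervals (`card_pairs_le`). Hence the
vertices newly reached along one page from `n` labelled intervals fall into at most `4n` groups,
each of one owner and consecutive among these vertices, which gives a new labelling
(`Labelling.exists_step`). Repeating this over `k` pages for `d` rounds, and keeping the old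
labellings, yields at most `(k+1)^d` labellings of total size at most `(4k+1)^d |H|`. Every edge of
`H` appears between two labelled intervals, and a second use of `card_pairs_le` gives `‖H‖ ≤
4k((k+1)(4k+1))^d |H|`. -/

/-- A cut of a linearly ordered set into at most `size + 1` consecutive intervals, with a label on
all intervals but the first. -/
structure Labelling (V W : Type*) [LinearOrder V] where
  pos : V → ℕ
  mono : Monotone pos
  size : ℕ
  pos_le : ∀ v, pos v ≤ size
  label : ℕ → Option W
  label_zero : label 0 = none

/-! ### Cuts into intervals and non-crossing edges -/

section

variable {V W : Type*} [LinearOrder V]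

open Classical in
/-- A function whose fibres on `L` are consecutive is refined by a labelling with one interval for
each value. -/
theorem exists_labelling {τ : Type*} (own : V → Option W) (L : Set V) (g : V → τ) (T : Finset τ)
    (hT : ∀ y ∈ L, g y ∈ T) (hown : ∀ y ∈ L, ∀ y' ∈ L, g y = g y' → own y = own y')
    (hcont : ∀ y₁ ∈ L, ∀ y₂ ∈ L, ∀ y₃ ∈ L, y₁ < y₂ → y₂ < y₃ → g y₁ = g y₃ → g y₂ = g y₁) :
    ∃ s : Labelling V W, s.size = T.card ∧ ∀ y ∈ L, s.label (s.pos y) = own y := by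
  -- The position of `v` is the number of values seen up to `v`. It is `0` only before the first
  -- element of `L`, so interval `0` needs no label.
  let F : V → Finset τ := fun v => T.filter fun t => ∃ y ∈ L, g y = t ∧ y ≤ v
  have hF : Monotone F := fun v v' hv t ht => by
    simp only [F, Finset.mem_filter] at ht ⊢
    obtain ⟨h, y, hy, hg, hle⟩ := ht
    exact ⟨h, y, hy, hg, hle.trans hv⟩
  have hself : ∀ y ∈ L, g y ∈ F y := fun y hy => by
    simp only [F, Finset.mem_filter]
    exact ⟨hT y hy, y, hy, rfl, le_rfl⟩
  have key : ∀ y ∈ L, ∀ y' ∈ L, y ≤ y' → (F y).card = (F y').card → g y = g y' := by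
    intro y hy y' hy' hle hc
    have he : F y = F y' := Finset.eq_of_subset_of_card_le (hF hle) hc.ge
    have h := hself y' hy'
    rw [← he] at h
    simp only [F, Finset.mem_filter] at h
    obtain ⟨-, z, hz, hg, hzy⟩ := h
    rcases hzy.eq_or_lt with rfl | h1
    · exact hg
    rcases hle.eq_or_lt with rfl | h2
    · rfl
    exact (hcont z hz y hy y' hy' h1 h2 hg).trans hg
  have key' : ∀ y ∈ L, ∀ y' ∈ L, (F y).card = (F y').card → g y = g y' := by
    intro y hy y' hy' hc
    rcases le_total y y' with h | h
    · exact key y hy y' hy' h hc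
    · exact (key y' hy' y hy h hc.symm).symm
  refine ⟨⟨fun v => (F v).card, fun v v' h => Finset.card_le_card (hF h), T.card,
    fun v => Finset.card_le_card (Finset.filter_subset _ _),
    fun i => if h : ∃ y ∈ L, (F y).card = i then own h.choose else none, ?_⟩, rfl, ?_⟩
  · rw [dif_neg]
    rintro ⟨y, hy, h⟩
    have := hself y hy
    rw [Finset.card_eq_zero.1 h] at this
    simp at this
  · intro y hy
    have h : ∃ y' ∈ L, (F y').card = (F y).card := ⟨y, hy, rfl⟩
    change (if h : ∃ y' ∈ L, (F y').card = (F y).card then own h.choose else none) = own y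
    rw [dif_pos h]
    exact hown _ h.choose_spec.1 _ hy (key' _ h.choose_spec.1 _ hy h.choose_spec.2)

open Classical in
/-- Contracting the two ends of non-crossing edges along two cuts into intervals leaves few edges. -/
theorem card_pairs_le {q q' : V → ℕ} (hq : Monotone q) (hq' : Monotone q') (R : V → V → Prop)
    (hR : ∀ u v, R u v → u < v)
    (hcross : ∀ u v u' v', R u v → R u' v' → u < u' → v < v' → v ≤ u')
    (T D : Finset (ℕ × ℕ)) (A B : Finset ℕ)
    (hT : ∀ p ∈ T, ∃ u v, R u v ∧ q u = p.1 ∧ q' v = p.2)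
    (hA : ∀ p ∈ T, p.1 ∈ A) (hB : ∀ p ∈ T, p.2 ∈ B)
    (hD : ∀ p ∈ T, (∃ w, q w = p.1 ∧ q' w = p.2) → p ∈ D) :
    T.card ≤ A.card + B.card + D.card := by
  let T₁ := T.filter fun p => ∀ b, (p.1, b) ∈ T → b ≤ p.2
  let T₂ := T.filter fun p => ∀ a, (a, p.2) ∈ T → p.1 ≤ a
  have h1 : T₁.card ≤ A.card := by
    refine Finset.card_le_card_of_injOn Prod.fst
      (fun p hp => hA p (Finset.mem_filter.1 hp).1) ?_
    rintro ⟨a, b⟩ hp ⟨a', b'⟩ hp' (rfl : a = a')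
    have h := Finset.mem_filter.1 hp
    have h' := Finset.mem_filter.1 hp'
    exact Prod.ext rfl (le_antisymm (h'.2 b h.1) (h.2 b' h'.1))
  have h2 : T₂.card ≤ B.card := by
    refine Finset.card_le_card_of_injOn Prod.snd
      (fun p hp => hB p (Finset.mem_filter.1 hp).1) ?_
    rintro ⟨a, b⟩ hp ⟨a', b'⟩ hp' (rfl : b = b')
    have h := Finset.mem_filter.1 hp
    have h' := Finset.mem_filter.1 hp'
    exact Prod.ext (le_antisymm (h.2 a' h'.1) (h'.2 a h.1)) rfl
  -- A pair that is neither the last for its left interval nor the first for its right interval has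
  -- an edge from its left interval to a later one, and an edge to its right interval from an
  -- earlier one. As these do not cross, the second ends no later than the first begins, which
  -- forces the two intervals of the pair to meet.
  have h3 : T ⊆ T₁ ∪ T₂ ∪ D := by
    rintro ⟨a, b⟩ hp
    by_contra hne
    simp only [Finset.mem_union, not_or, T₁, T₂, Finset.mem_filter, not_and, not_forall,
      not_le] at hne
    obtain ⟨⟨n1, n2⟩, n3⟩ := hne
    obtain ⟨b₂, hb₂, hlt₂⟩ := n1 hp
    obtain ⟨a₃, ha₃, hlt₃⟩ := n2 hp
    obtain ⟨u, v, huv, rfl, rfl⟩ := hT _ hp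
    obtain ⟨u₂, v₂, huv₂, e₂, rfl⟩ := hT _ hb₂
    obtain ⟨u₃, v₃, huv₃, rfl, e₃⟩ := hT _ ha₃
    simp only at e₂ e₃ hlt₂ hlt₃ n3 hp
    have hu : u₃ < u₂ := hq.reflect_lt (by omega)
    have hv : v₃ < v₂ := hq'.reflect_lt (by omega)
    have hle := hcross _ _ _ _ huv₃ huv₂ hu hv
    have huv' := hR _ _ huv
    refine n3 (hD _ hp ?_)
    rcases le_or_gt v₃ u with h | h
    · refine ⟨u, rfl, le_antisymm (hq' huv'.le) ?_⟩
      have := hq' h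
      simp only
      omega
    · refine ⟨v₃, le_antisymm ?_ (hq h.le), e₃⟩
      have := hq hle
      simp only
      omega
  calc T.card ≤ (T₁ ∪ T₂ ∪ D).card := Finset.card_le_card h3
    _ ≤ (T₁ ∪ T₂).card + D.card := Finset.card_union_le _ _
    _ ≤ T₁.card + T₂.card + D.card := by gcongr; exact Finset.card_union_le _ _
    _ ≤ _ := by gcongr

/-- A symmetric relation without crossing edges. -/
structure IsPage (E : V → V → Prop) : Prop where
  symm : ∀ u v, E u v → E v u
  noncrossing : ∀ u v u' v', E u v → E u' v' → u < u' → u' < v → ¬ v < v'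

/-- The labelling marks the vertex `v` with its owner. -/
def Labelling.Covers (s : Labelling V W) (own : V → Option W) (v : V) : Prop :=
  own v ≠ none ∧ s.label (s.pos v) = own v

open Classical in
/-- One step along the edges of a page out of the vertices covered by a labelling `s`. A step
inside an interval of `s` stays in `s`. -/
theorem Labelling.exists_step (s : Labelling V W) (own : V → Option W) {E : V → V → Prop}
    (hE : IsPage E) : ∃ s' : Labelling V W, s'.size ≤ 4 * s.size ∧
      ∀ x y, s.Covers own x → E x y → own y = own x → ¬ s.Covers own y → s'.Covers own y := by
  set q := s.pos with hq
  -- Steps inside an interval are left out: the vertex reached has the owner of that interval and is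
  -- already covered.
  let L : Set V := {y | ∃ x, s.Covers own x ∧ E x y ∧ own y = own x ∧ q x ≠ q y}
  have hL : ∀ y, ∃ x, y ∈ L → s.Covers own x ∧ E x y ∧ own y = own x ∧ q x ≠ q y := by
    intro y
    by_cases h : y ∈ L
    · obtain ⟨x, hx⟩ := h
      exact ⟨x, fun _ => hx⟩
    · exact ⟨y, fun h' => absurd h' h⟩
  choose p hp using hL
  let I := Finset.range (s.size + 1)
  let T₁ := (I ×ˢ I).filter fun t => ∃ u v, (u < v ∧ E u v ∧ q u ≠ q v ∧ s.label (q u) ≠ none) ∧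
    q u = t.1 ∧ q v = t.2
  let T₂ := (I ×ˢ I).filter fun t => ∃ u v, (u < v ∧ E u v ∧ q u ≠ q v ∧ s.label (q v) ≠ none) ∧
    q u = t.1 ∧ q v = t.2
  have hpos : ∀ v, s.label (q v) ≠ none → 0 < q v := by
    intro v hv
    rcases Nat.eq_zero_or_pos (q v) with h | h
    · rw [h, s.label_zero] at hv
      exact absurd rfl hv
    · exact h
  have hnc : ∀ u v u' v', E u v → E u' v' → u < u' → v < v' → v ≤ u' :=
    fun u v u' v' h h' hu hv => not_lt.1 fun hlt => hE.noncrossing _ _ _ _ h h' hu hlt hv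
  -- Distinct intervals of the same cut are disjoint, so `D` is empty. A labelled left end has
  -- positive index, and so has the interval to its right.
  have c1 : T₁.card ≤ 2 * s.size := by
    have := card_pairs_le s.mono s.mono
      (fun u v => u < v ∧ E u v ∧ q u ≠ q v ∧ s.label (q u) ≠ none) (fun u v h => h.1)
      (fun u v u' v' h h' => hnc u v u' v' h.2.1 h'.2.1) T₁ ∅ (Finset.Icc 1 s.size)
      (Finset.Icc 1 s.size) (fun t ht => (Finset.mem_filter.1 ht).2) ?_ ?_ ?_
    · simp only [Nat.card_Icc, Finset.card_empty] at this
      omega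
    · intro t ht
      obtain ⟨-, u, v, ⟨-, -, -, h⟩, e, -⟩ := Finset.mem_filter.1 ht
      rw [← e]
      exact Finset.mem_Icc.2 ⟨hpos u h, s.pos_le u⟩
    · intro t ht
      obtain ⟨-, u, v, ⟨hlt, -, -, h⟩, -, e⟩ := Finset.mem_filter.1 ht
      rw [← e]
      exact Finset.mem_Icc.2 ⟨(hpos u h).trans_le (s.mono hlt.le), s.pos_le v⟩
    · rintro t ht ⟨w, e1, e2⟩
      obtain ⟨-, u, v, ⟨-, -, hne, -⟩, e3, e4⟩ := Finset.mem_filter.1 ht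
      exact absurd ((e3.trans e1.symm).trans (e2.trans e4.symm)) hne
  -- Here the left end may lie in interval `0`, but not in the last interval, since the right end
  -- lies in a later one.
  have c2 : T₂.card ≤ 2 * s.size := by
    have := card_pairs_le s.mono s.mono
      (fun u v => u < v ∧ E u v ∧ q u ≠ q v ∧ s.label (q v) ≠ none) (fun u v h => h.1)
      (fun u v u' v' h h' => hnc u v u' v' h.2.1 h'.2.1) T₂ ∅ (Finset.range s.size)
      (Finset.Icc 1 s.size) (fun t ht => (Finset.mem_filter.1 ht).2) ?_ ?_ ?_
    · simp only [Nat.card_Icc, Finset.card_range, Finset.card_empty] at this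
      omega
    · intro t ht
      obtain ⟨-, u, v, ⟨hlt, -, hne, h⟩, e, -⟩ := Finset.mem_filter.1 ht
      rw [← e]
      exact Finset.mem_range.2 (((s.mono hlt.le).lt_of_ne hne).trans_le (s.pos_le v))
    · intro t ht
      obtain ⟨-, u, v, ⟨hlt, -, -, h⟩, -, e⟩ := Finset.mem_filter.1 ht
      rw [← e]
      exact Finset.mem_Icc.2 ⟨hpos v h, s.pos_le v⟩
    · rintro t ht ⟨w, e1, e2⟩
      obtain ⟨-, u, v, ⟨-, -, hne, -⟩, e3, e4⟩ := Finset.mem_filter.1 ht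
      exact absurd ((e3.trans e1.symm).trans (e2.trans e4.symm)) hne
  have hI : ∀ v, q v ∈ I := fun v => Finset.mem_range.2 (Nat.lt_succ_of_le (s.pos_le v))
  obtain ⟨s', hs', hcov⟩ : ∃ s' : Labelling V W, s'.size = (T₁ ∪ T₂.image Prod.swap).card ∧
      ∀ y ∈ L, s'.label (s'.pos y) = own y := by
    refine exists_labelling own L (fun y => (q (p y), q y)) _ ?_ ?_ ?_
    · intro y hy
      obtain ⟨hc, hpe, -, hne⟩ := hp y hy
      have hl : s.label (q (p y)) ≠ none := by
        rw [hc.2]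
        exact hc.1
      rcases lt_or_gt_of_ne (show p y ≠ y from fun h => hne (by rw [h])) with h | h
      · exact Finset.mem_union_left _ (Finset.mem_filter.2
          ⟨Finset.mem_product.2 ⟨hI _, hI _⟩, p y, y, ⟨h, hpe, hne, hl⟩, rfl, rfl⟩)
      · refine Finset.mem_union_right _ (Finset.mem_image.2 ⟨(q y, q (p y)), Finset.mem_filter.2
          ⟨Finset.mem_product.2 ⟨hI _, hI _⟩, y, p y, ⟨h, hE.symm _ _ hpe, hne.symm, hl⟩, rfl, rfl⟩,
          rfl⟩)
    · intro y hy y' hy' he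
      obtain ⟨hc, -, ho, -⟩ := hp y hy
      obtain ⟨hc', -, ho', -⟩ := hp y' hy'
      rw [ho, ho', ← hc.2, ← hc'.2]
      exact congrArg s.label (congrArg Prod.fst he)
    · intro y₁ hy₁ y₂ hy₂ y₃ hy₃ h12 h23 he
      obtain ⟨-, E₁, -, n₁⟩ := hp y₁ hy₁
      obtain ⟨-, E₂, -, n₂⟩ := hp y₂ hy₂
      obtain ⟨-, E₃, -, n₃⟩ := hp y₃ hy₃
      obtain ⟨ea, eb⟩ := Prod.mk.inj he
      have m12 := s.mono h12.le
      have m23 := s.mono h23.le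
      rw [← hq] at m12 m23
      have e2 : q y₂ = q y₁ := by omega
      have lt : ∀ {u v : V}, q u < q v → u < v := fun h => s.mono.reflect_lt h
      -- Among the vertices of one interval, non-crossing puts those with a partner to the left
      -- before those with a partner to the right, and on each side the partners occur in reverse
      -- order. So the partner of `y₂` cannot leave the interval shared by the partners of `y₁` and
      -- `y₃`.
      refine Prod.ext (by_contra fun hne => ?_) e2
      simp only at hne
      rcases lt_or_gt_of_ne n₁ with hab | hab
      · rcases lt_or_gt_of_ne hne with h | h
        · exact hE.noncrossing _ _ _ _ E₂ E₃ (lt (by omega)) (lt (by omega)) h23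
        · rcases lt_or_gt_of_ne n₂ with h' | h'
          · exact hE.noncrossing _ _ _ _ E₁ E₂ (lt (by omega)) (lt (by omega)) h12
          · exact hE.noncrossing _ _ _ _ E₃ (hE.symm _ _ E₂) (lt (by omega)) h23 (lt (by omega))
      · rcases lt_or_gt_of_ne hne with h | h
        · rcases lt_or_gt_of_ne n₂ with h' | h'
          · exact hE.noncrossing _ _ _ _ E₂ (hE.symm _ _ E₁) (lt (by omega)) h12 (lt (by omega))
          · exact hE.noncrossing _ _ _ _ (hE.symm _ _ E₂) (hE.symm _ _ E₃) h23 (lt (by omega))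
              (lt (by omega))
        · exact hE.noncrossing _ _ _ _ (hE.symm _ _ E₁) (hE.symm _ _ E₂) h12 (lt (by omega))
            (lt (by omega))
  refine ⟨s', ?_, ?_⟩
  · rw [hs']
    have := Finset.card_union_le T₁ (T₂.image Prod.swap)
    have := Finset.card_image_le (s := T₂) (f := Prod.swap)
    omega
  · intro x y hx hxy ho hy
    have hne : own y ≠ none := by
      rw [ho]
      exact hx.1
    refine ⟨hne, hcov y ⟨x, hx, hxy, ho, fun he => hy ⟨hne, ?_⟩⟩⟩
    rw [← hq, ← he, ho]
    exact hx.2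

end

/-! ### Covering balls by labellings and counting edges -/

section

variable {V W : Type*} [LinearOrder V]

/-- The vertices that can be reached from a root in `r` steps between vertices of the same owner. -/
def ownBall (G : SimpleGraph V) (own : V → Option W) (root : W → V) : ℕ → Set V
  | 0 => Set.range root
  | r + 1 => ownBall G own root r ∪ {y | ∃ x ∈ ownBall G own root r, G.Adj x y ∧ own y = own x}

/-- Initially every root is its own interval. In each round a labelling is kept and also replaced by
its `k` successors, one per page, each at most four times as large; this gives the factors `k + 1`
and `4k + 1`. -/
theorem exists_labelling_family [Finite W] {k : ℕ} {G : SimpleGraph V} (E : Fin k → V → V → Prop)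
    (hE : ∀ c, IsPage (E c)) (hG : ∀ u v, G.Adj u v → ∃ c, E c u v) (own : V → Option W)
    (root : W → V) (hroot : ∀ w, own (root w) = some w) (r : ℕ) :
    ∃ (ι : Type) (_ : Fintype ι) (s : ι → Labelling V W), Fintype.card ι ≤ (k + 1) ^ r ∧
      ∑ i, (s i).size ≤ (4 * k + 1) ^ r * Nat.card W ∧
      ∀ v ∈ ownBall G own root r, ∃ i, (s i).Covers own v := by
  classical
  induction r with
  | zero =>
    have := Fintype.ofFinite W
    obtain ⟨s, hs, hcov⟩ := exists_labelling own (Set.range root) id (Finset.univ.image root)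
      (by simp) (by rintro y - y' - (rfl : y = y'); rfl)
      (by
        rintro y₁ - y₂ - y₃ - h12 h23 (rfl : y₁ = y₃)
        exact absurd (h12.trans h23) (lt_irrefl _))
    refine ⟨Unit, inferInstance, fun _ => s, by simp, ?_, ?_⟩
    · have := Finset.card_image_le (s := (Finset.univ : Finset W)) (f := root)
      simpa [hs] using this
    · rintro v ⟨w, rfl⟩
      exact ⟨(), by rw [hroot w]; exact Option.some_ne_none w, hcov _ ⟨w, rfl⟩⟩
  | succ r ih =>
    obtain ⟨ι, _, s, hcard, hsize, hcov⟩ := ih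
    choose t ht htc using fun i c => (s i).exists_step own (hE c)
    refine ⟨ι × Option (Fin k), inferInstance, fun p => p.2.elim (s p.1) (t p.1), ?_, ?_, ?_⟩
    · rw [Fintype.card_prod, Fintype.card_option, Fintype.card_fin, pow_succ]
      exact Nat.mul_le_mul_right _ hcard
    · rw [Fintype.sum_prod_type]
      calc ∑ i, ∑ o : Option (Fin k), (Option.elim o (s i) (t i)).size
          ≤ ∑ i, (4 * k + 1) * (s i).size := by
            refine Finset.sum_le_sum fun i _ => ?_
            rw [Fintype.sum_option]
            have : ∑ c, (t i c).size ≤ ∑ _c : Fin k, 4 * (s i).size :=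
              Finset.sum_le_sum fun c _ => ht i c
            simp only [Finset.sum_const, Finset.card_univ, Fintype.card_fin, smul_eq_mul] at this
            simp only [Option.elim]
            linarith
        _ = (4 * k + 1) * ∑ i, (s i).size := by rw [Finset.mul_sum]
        _ ≤ (4 * k + 1) * ((4 * k + 1) ^ r * Nat.card W) := Nat.mul_le_mul_left _ hsize
        _ = _ := by ring
    · have hmono : ∀ v, (∃ i, (s i).Covers own v) →
          ∃ p : ι × Option (Fin k), (p.2.elim (s p.1) (t p.1)).Covers own v :=
        fun v ⟨i, hi⟩ => ⟨(i, none), hi⟩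
      rintro v (hv | ⟨x, hx, hadj, ho⟩)
      · exact hmono v (hcov v hv)
      · obtain ⟨i, hi⟩ := hcov x hx
        obtain ⟨c, hc⟩ := hG x v hadj
        by_cases h : (s i).Covers own v
        · exact hmono v ⟨i, h⟩
        · exact ⟨(i, some c), htc i c x v hi hc ho h⟩

/-- An edge of `H` can be read off from the labellings covering its two ends, the page, and the pair
of intervals joined. Summing the bound `2(sᵢ + sⱼ)` on these pairs over all `(i, j, c)` gives `4k`
times the number of labellings times their total size. -/
theorem ncard_edgeSet_le [Finite W] {k : ℕ} {G : SimpleGraph V} (E : Fin k → V → V → Prop)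
    (hE : ∀ c, IsPage (E c)) (hG : ∀ u v, G.Adj u v → ∃ c, E c u v) (own : V → Option W)
    (root : W → V) (hroot : ∀ w, own (root w) = some w) (r : ℕ) (H : SimpleGraph W)
    (hH : ∀ a b, H.Adj a b → ∃ u ∈ ownBall G own root r, ∃ v ∈ ownBall G own root r,
      own u = some a ∧ own v = some b ∧ G.Adj u v) :
    H.edgeSet.ncard ≤ 4 * k * ((k + 1) * (4 * k + 1)) ^ r * Nat.card W := by
  classical
  obtain ⟨ι, _, s, hcard, hsize, hcov⟩ := exists_labelling_family E hE hG own root hroot r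
  let T : ι × ι × Fin k → Finset (ℕ × ℕ) := fun x =>
    (Finset.Icc 1 (s x.1).size ×ˢ Finset.Icc 1 (s x.2.1).size).filter fun p =>
      ∃ u v, (u < v ∧ E x.2.2 u v) ∧ (s x.1).pos u = p.1 ∧ (s x.2.1).pos v = p.2
  have hTcard : ∀ x, (T x).card ≤ 2 * ((s x.1).size + (s x.2.1).size) := by
    rintro ⟨i, j, c⟩
    let D := (T (i, j, c)).filter fun p => ∃ w, (s i).pos w = p.1 ∧ (s j).pos w = p.2
    have hI : ∀ p ∈ T (i, j, c), p.1 ∈ Finset.Icc 1 (s i).size ∧ p.2 ∈ Finset.Icc 1 (s j).size :=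
      fun p hp => Finset.mem_product.1 (Finset.mem_filter.1 hp).1
    -- The pairs of intervals sharing a vertex form a chain in the product order, so they are
    -- determined by the sum of their indices.
    have hD : D.card ≤ (s i).size + (s j).size := by
      have : D.card ≤ (Finset.Icc 1 ((s i).size + (s j).size)).card := by
        refine Finset.card_le_card_of_injOn (fun p => p.1 + p.2) ?_ ?_
        · intro p hp
          have := hI p (Finset.mem_filter.1 hp).1
          simp only [Finset.mem_Icc] at this
          simp only [Finset.coe_Icc, Set.mem_Icc]
          omega
        · intro p hp p' hp' he
          obtain ⟨w, e1, e2⟩ := (Finset.mem_filter.1 hp).2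
          obtain ⟨w', e1', e2'⟩ := (Finset.mem_filter.1 hp').2
          simp only at he
          rcases le_total w w' with h | h
          · have := (s i).mono h
            have := (s j).mono h
            exact Prod.ext (by omega) (by omega)
          · have := (s i).mono h
            have := (s j).mono h
            exact Prod.ext (by omega) (by omega)
      simpa using this
    have := card_pairs_le (s i).mono (s j).mono (fun u v => u < v ∧ E c u v) (fun u v h => h.1)
      (fun u v u' v' h h' hu hv => not_lt.1 fun hlt =>
        (hE c).noncrossing _ _ _ _ h.2 h'.2 hu hlt hv)
      (T (i, j, c)) D _ _ (fun p hp => (Finset.mem_filter.1 hp).2) (fun p hp => (hI p hp).1)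
      (fun p hp => (hI p hp).2) (fun p hp hw => Finset.mem_filter.2 ⟨hp, hw⟩)
    simp only [Nat.card_Icc] at this
    simp only
    omega
  have hsub : Sym2.map some '' H.edgeSet ⊆ ((Finset.univ.sigma T).image
      fun x => s((s x.1.1).label x.2.1, (s x.1.2.1).label x.2.2) : Finset (Sym2 (Option W))) := by
    have hlt : ∀ a b u v, u ∈ ownBall G own root r → v ∈ ownBall G own root r → own u = some a →
        own v = some b → G.Adj u v → u < v → s(some a, some b) ∈ ((Finset.univ.sigma T).image
      fun x => s((s x.1.1).label x.2.1, (s x.1.2.1).label x.2.2) : Finset (Sym2 (Option W))) := by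
      intro a b u v hu hv ha hb hadj huv
      obtain ⟨i, hi⟩ := hcov u hu
      obtain ⟨j, hj⟩ := hcov v hv
      obtain ⟨c, hc⟩ := hG u v hadj
      have hpos : ∀ (i : ι) (v : V), (s i).Covers own v →
          (s i).pos v ∈ Finset.Icc 1 (s i).size := by
        intro i v hv
        refine Finset.mem_Icc.2 ⟨Nat.one_le_iff_ne_zero.2 fun h0 => hv.1 ?_, (s i).pos_le v⟩
        rw [← hv.2, h0, (s i).label_zero]
      refine Finset.mem_image.2 ⟨⟨(i, j, c), ((s i).pos u, (s j).pos v)⟩, ?_, ?_⟩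
      · exact Finset.mem_sigma.2 ⟨Finset.mem_univ _, Finset.mem_filter.2
          ⟨Finset.mem_product.2 ⟨hpos i u hi, hpos j v hj⟩, u, v, ⟨huv, hc⟩, rfl, rfl⟩⟩
      · simp only [hi.2, hj.2, ha, hb]
    rintro _ ⟨e, he, rfl⟩
    induction e using Sym2.ind with
    | _ a b =>
      obtain ⟨u, hu, v, hv, ha, hb, hadj⟩ := hH a b he
      rw [Sym2.map_mk]
      rcases lt_or_gt_of_ne hadj.ne with h | h
      · exact hlt a b u v hu hv ha hb hadj h
      · have := hlt b a v u hv hu hb ha hadj.symm h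
        rwa [Sym2.eq_swap] at this
  have hsum : ∑ x : ι × ι × Fin k, 2 * ((s x.1).size + (s x.2.1).size) =
      4 * k * Fintype.card ι * ∑ i, (s i).size := by
    simp only [Fintype.sum_prod_type, Finset.sum_const, Finset.card_univ, Fintype.card_fin,
      smul_eq_mul, mul_add, Finset.sum_add_distrib, ← Finset.mul_sum, Fintype.card_prod]
    ring
  calc H.edgeSet.ncard = (Sym2.map some '' H.edgeSet).ncard :=
        (Set.ncard_image_of_injective _ (Sym2.map.injective (Option.some_injective W))).symm
    _ ≤ _ := Set.ncard_le_ncard hsub (Finset.finite_toSet _)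
    _ ≤ (Finset.univ.sigma T).card := by
        rw [Set.ncard_coe_finset]
        exact Finset.card_image_le
    _ = ∑ x, (T x).card := Finset.card_sigma _ _
    _ ≤ ∑ x : ι × ι × Fin k, 2 * ((s x.1).size + (s x.2.1).size) :=
        Finset.sum_le_sum fun x _ => hTcard x
    _ = 4 * k * Fintype.card ι * ∑ i, (s i).size := hsum
    _ ≤ 4 * k * (k + 1) ^ r * ((4 * k + 1) ^ r * Nat.card W) := by gcongr
    _ = _ := by rw [mul_pow]; ring

end

/-! ### Stack layouts, shallow minors and subdivisions -/

theorem FinGraph.HasStackLayout.exists_pages {G : FinGraph.{u}} {k : ℕ} (h : G.HasStackLayout k) :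
    ∃ (_ : LinearOrder G.V) (E : Fin k → G.V → G.V → Prop), (∀ c, IsPage (E c)) ∧
      ∀ u v, G.graph.Adj u v → ∃ c, E c u v := by
  obtain ⟨G', ⟨page, hpage⟩, ⟨i⟩⟩ := h
  let _ : LinearOrder G.V := LinearOrder.lift' i i.injective
  have hlt : ∀ u v : G.V, u < v ↔ i u < i v := fun _ _ => Iff.rfl
  refine ⟨inferInstance, fun c u v => ∃ h : G'.Adj (i u) (i v), page ⟨s(i u, i v), h⟩ = c,
    fun c => ⟨?_, ?_⟩, fun u v h => ⟨_, i.map_adj_iff.2 h, rfl⟩⟩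
  · rintro u v ⟨h, rfl⟩
    refine ⟨h.symm, ?_⟩
    congr 2
    exact Sym2.eq_swap
  · rintro u v u' v' ⟨h, hc⟩ ⟨h', hc'⟩ h1 h2 h3
    rw [hlt] at h1 h2 h3
    refine hpage _ _ (hc.trans hc'.symm) ?_
    simp only [Crosses, Sym2.inf_mk, Sym2.sup_mk]
    rw [inf_eq_left.2 (h1.trans h2).le, inf_eq_left.2 (h2.trans h3).le,
      sup_eq_right.2 (h1.trans h2).le, sup_eq_right.2 (h2.trans h3).le]
    exact ⟨h1, h2, h3⟩

section

variable {V W : Type*}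

theorem ownBall_mono {G : SimpleGraph V} {own : V → Option W} {root : W → V} :
    Monotone (ownBall G own root) :=
  monotone_nat_of_le_succ fun _ => Set.subset_union_left

open Classical in
/-- The index of the set that contains a vertex. -/
noncomputable def owner (B : W → Set V) (v : V) : Option W :=
  if h : ∃ w, v ∈ B w then some h.choose else none

theorem owner_eq {B : W → Set V} (hB : ∀ v w w', v ∈ B w → v ∈ B w' → w = w') {v : V} {w : W}
    (h : v ∈ B w) : owner B v = some w := by
  have h' : ∃ w, v ∈ B w := ⟨w, h⟩
  rw [owner, dif_pos h', hB v _ _ h'.choose_spec h]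

variable [LinearOrder V] [Finite W]

theorem IsShallowMinor.ncard_edgeSet_le {k d : ℕ} {G : SimpleGraph V} (E : Fin k → V → V → Prop)
    (hE : ∀ c, IsPage (E c)) (hG : ∀ u v, G.Adj u v → ∃ c, E c u v) {H : SimpleGraph W}
    (h : IsShallowMinor d H G) :
    H.edgeSet.ncard ≤ 4 * k * ((k + 1) * (4 * k + 1)) ^ d * Nat.card W := by
  obtain ⟨X, hX, hrad, ⟨f⟩⟩ := h
  have hB : ∀ v w w', v ∈ (f w).supp → v ∈ (f w').supp → w = w' := fun v w w' h h' =>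
    f.injective (h.symm.trans h')
  have hcenter : ∀ w, ∃ x : (f w).supp, ∀ v, (f w).toSimpleGraph.edist x v ≤ d := by
    intro w
    have : Nonempty (f w).supp := (f w).nonempty_supp.to_subtype
    obtain ⟨x, hx⟩ := (f w).toSimpleGraph.exists_eccent_eq_radius
    exact ⟨x, fun v => SimpleGraph.edist_le_eccent.trans (hx.trans_le (hrad _))⟩
  choose root hroot using hcenter
  have hwalk : ∀ w (u v : (f w).supp) (p : (f w).toSimpleGraph.Walk u v) (j : ℕ),
      u.1 ∈ ownBall G (owner fun w => (f w).supp) (fun w => (root w).1) j →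
      v.1 ∈ ownBall G (owner fun w => (f w).supp) (fun w => (root w).1) (j + p.length) := by
    intro w u v p
    induction p with
    | nil => exact fun j h => h
    | @cons u x v hadj p ih =>
      intro j hj
      rw [SimpleGraph.Walk.length_cons, add_comm p.length, ← add_assoc]
      refine ih (j + 1) (Or.inr ⟨u.1, hj, hX hadj, ?_⟩)
      rw [owner_eq hB x.2, owner_eq hB u.2]
  have hball : ∀ w, ∀ v ∈ (f w).supp,
      v ∈ ownBall G (owner fun w => (f w).supp) (fun w => (root w).1) d := by
    intro w v hv
    have hd := hroot w ⟨v, hv⟩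
    obtain ⟨p, hp⟩ := SimpleGraph.exists_walk_of_edist_ne_top
      (ne_top_of_le_ne_top (ENat.natCast_ne_top d) hd)
    rw [← hp, Nat.cast_le] at hd
    have := hwalk w _ _ p 0 ⟨w, rfl⟩
    rw [zero_add] at this
    exact ownBall_mono hd this
  refine StackExpansion.ncard_edgeSet_le E hE hG (owner fun w => (f w).supp) (fun w => (root w).1)
    (fun w => owner_eq hB (root w).2) d H fun a b hab => ?_
  obtain ⟨-, u, v, hu, hv, huv⟩ := f.toHom.map_adj hab
  exact ⟨u, hball a u hu, v, hball b v hv, owner_eq hB hu, owner_eq hB hv, huv⟩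

/-- Each path has at most `2d + 1` edges, so both halves stay within `d` steps of their ends. The
halves at an original vertex form its set, and the edge at the cut joins two sets. -/
theorem IsSubdivision.ncard_edgeSet_le {k d : ℕ} {G : SimpleGraph V} (E : Fin k → V → V → Prop)
    (hE : ∀ c, IsPage (E c)) (hG : ∀ u v, G.Adj u v → ∃ c, E c u v) {H : SimpleGraph W}
    (h : IsSubdivision (2 * d) G H) :
    H.edgeSet.ncard ≤ 4 * k * ((k + 1) * (4 * k + 1)) ^ d * Nat.card W := by
  obtain ⟨φ, P, hpath, hrev, hend, hdisj, -, -⟩ := h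
  have hW := Fintype.ofFinite W
  let en := Fintype.equivFin W
  -- The midpoint of a path of even length goes to the end with the smaller number under `en`.
  let near : W → W → ℕ → ℕ → Prop := fun a b i l => 2 * i < l ∨ (2 * i = l ∧ en a < en b)
  let B : W → Set V := fun a => {x | x = φ a ∨ ∃ b, ∃ h : H.Adj a b, ∃ i,
    near a b i (P a b h).length ∧ (P a b h).getVert i = x}
  have hpos : ∀ a b (h : H.Adj a b), 0 < (P a b h).length := by
    intro a b h
    rw [Nat.pos_iff_ne_zero]
    exact fun h0 => h.ne (φ.injective (SimpleGraph.Walk.eq_of_length_eq_zero h0))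
  have hφ : ∀ a b (h : H.Adj a b) i w, near a b i (P a b h).length →
      (P a b h).getVert i = φ w → w = a := by
    intro a b h i w hi he
    have hl := hpos a b h
    have hil : i < (P a b h).length := by rcases hi with hi | ⟨hi, -⟩ <;> omega
    rcases hend a b h w (he ▸ (P a b h).getVert_mem_support i) with rfl | rfl
    · rfl
    · have := ((hpath a w h).1.getVert_eq_end_iff hil.le).1 he
      omega
  have hB : ∀ v w w', v ∈ B w → v ∈ B w' → w = w' := by
    rintro x a a' (rfl | ⟨b, h, i, hi, rfl⟩) (he | ⟨b', h', i', hi', he⟩)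
    · exact φ.injective he
    · exact hφ a' b' h' i' a hi' he
    · exact (hφ a b h i a' hi he).symm
    · by_cases hs : s(a, b) = s(a', b')
      · rcases Sym2.eq_iff.1 hs with ⟨rfl, -⟩ | ⟨rfl, rfl⟩
        · rfl
        · exfalso
          have hl := hpos a b h
          rw [hrev a b h, SimpleGraph.Walk.getVert_reverse] at he
          rw [hrev a b h, SimpleGraph.Walk.length_reverse] at hi'
          have hi2 : 2 * i ≤ (P a b h).length := by rcases hi with hi | hi <;> omega
          -- The indices from the two ends add up to the length. Since neither exceeds half of it,
          -- both are midpoints, and the tie would be won by both ends.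
          have := (hpath a b h).1.getVert_injOn (by simp) (by simp; omega) he
          rcases hi with hi | ⟨hi, hlt⟩ <;> rcases hi' with hi' | ⟨hi', hlt'⟩
          · omega
          · omega
          · omega
          · exact lt_asymm hlt hlt'
      · obtain ⟨w, hw⟩ := hdisj a b h a' b' h' hs _ ((P a b h).getVert_mem_support i)
          (he ▸ (P a' b' h').getVert_mem_support i')
        rw [← hφ a b h i w hi hw.symm, hφ a' b' h' i' w hi' (he.trans hw.symm)]
  have hmem : ∀ a b (h : H.Adj a b) i, near a b i (P a b h).length →
      (P a b h).getVert i ∈ B a := fun a b h i hi => Or.inr ⟨b, h, i, hi, rfl⟩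
  have hball : ∀ a b (h : H.Adj a b) i, near a b i (P a b h).length →
      (P a b h).getVert i ∈ ownBall G (owner B) φ i := by
    intro a b h i
    induction i with
    | zero => exact fun _ => ⟨a, by simp⟩
    | succ i ih =>
      intro hi
      have hl : 2 * i + 2 ≤ (P a b h).length := by rcases hi with hi | ⟨hi, -⟩ <;> omega
      have hi' : near a b i (P a b h).length := Or.inl (by omega)
      refine Or.inr ⟨_, ih hi', (P a b h).adj_getVert_succ (by omega), ?_⟩
      rw [owner_eq hB (hmem a b h _ hi), owner_eq hB (hmem a b h _ hi')]
  have hball' : ∀ a b (h : H.Adj a b) i, near a b i (P a b h).length →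
      (P a b h).getVert i ∈ ownBall G (owner B) φ d := by
    intro a b h i hi
    have := (hpath a b h).2
    exact ownBall_mono (by rcases hi with hi | ⟨hi, -⟩ <;> omega) (hball a b h i hi)
  have hlt : ∀ a b, H.Adj a b → en a < en b → ∃ u ∈ ownBall G (owner B) φ d,
      ∃ v ∈ ownBall G (owner B) φ d, owner B u = some a ∧ owner B v = some b ∧ G.Adj u v := by
    intro a b h hab
    have hl := hpos a b h
    -- Since `a` wins ties, the cut lies between the vertices `m` and `m + 1` of the path for either
    -- parity of the length.
    obtain ⟨m, hm⟩ : ∃ m, m = (P a b h).length / 2 := ⟨_, rfl⟩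
    have hu : near a b m (P a b h).length := by
      rcases (show 2 * m < (P a b h).length ∨ 2 * m = (P a b h).length by omega) with h1 | h1
      · exact Or.inl h1
      · exact Or.inr ⟨h1, hab⟩
    have hv : near b a ((P a b h).length - (m + 1)) (P b a h.symm).length := by
      rw [hrev a b h, SimpleGraph.Walk.length_reverse]
      exact Or.inl (by omega)
    have he : (P b a h.symm).getVert ((P a b h).length - (m + 1)) = (P a b h).getVert (m + 1) := by
      rw [hrev a b h, SimpleGraph.Walk.getVert_reverse]
      congr 1
      omega
    have hv1 := hball' b a h.symm _ hv
    have hv2 := hmem b a h.symm _ hv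
    rw [he] at hv1 hv2
    exact ⟨_, hball' a b h m hu, _, hv1, owner_eq hB (hmem a b h m hu), owner_eq hB hv2,
      (P a b h).adj_getVert_succ (by omega)⟩
  refine StackExpansion.ncard_edgeSet_le E hE hG (owner B) φ
    (fun w => owner_eq hB (Or.inl rfl)) d H fun a b hab => ?_
  rcases lt_or_gt_of_ne (en.injective.ne hab.ne) with h | h
  · exact hlt a b hab h
  · obtain ⟨u, hu, v, hv, hub, hva, huv⟩ := hlt b a hab.symm h
    exact ⟨v, hv, u, hu, hva, hub, huv.symm⟩

end

theorem FinGraph.density_le {H : FinGraph.{u}} {c : ℝ} (hc : 0 ≤ c)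
    (h : (H.graph.edgeSet.ncard : ℝ) ≤ c * Nat.card H.V) : H.density ≤ c :=
  div_le_of_le_mul₀ (Nat.cast_nonneg _) hc h

/-- For `k ≥ 3` one has `(k+1)(4k+1) ≤ (5k-5)²`, and the remaining factor `(5k-5)/(5k-6)` exceeds
`1`. -/
theorem growth_le {k : ℕ} (hk : 3 ≤ k) (r : ℕ) :
    4 * (k : ℝ) * (((k : ℝ) + 1) * (4 * k + 1)) ^ r ≤
      4 * (k : ℝ) * (5 * (k : ℝ) - 5) ^ (2 * r + 1) / (5 * (k : ℝ) - 6) := by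
  have hk' : (3 : ℝ) ≤ k := by exact_mod_cast hk
  rw [le_div_iff₀ (by linarith)]
  calc 4 * (k : ℝ) * (((k : ℝ) + 1) * (4 * k + 1)) ^ r * (5 * k - 6)
      ≤ 4 * (k : ℝ) * ((5 * k - 5) ^ 2) ^ r * (5 * k - 5) := by
        gcongr
        · linarith
        · nlinarith [mul_nonneg (sub_nonneg.2 hk') (sub_nonneg.2 hk')]
        · norm_num
    _ = _ := by rw [← pow_mul, pow_succ]; ring

end StackExpansion

theorem mainTheorem6 :
    (∀ C : Set StackExpansion.FinGraph.{u},
      (∃ k : ℕ, ∀ G ∈ C, G.stackNumber ≤ k) → StackExpansion.HasBoundedExpansion C) ∧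
    (∀ k : ℕ, 3 ≤ k → ∀ G : StackExpansion.FinGraph.{u}, G.HasStackLayout k → ∀ r : ℕ,
      StackExpansion.topGrad {G} r ≤
        ((4 * (k : ℝ) * (5 * (k : ℝ) - 5) ^ (2 * r + 1) / (5 * (k : ℝ) - 6) : ℝ) : EReal)) := by
  constructor
  · rintro C ⟨k, hk⟩
    refine ⟨fun d => 4 * (k : ℝ) * (((k : ℝ) + 1) * (4 * k + 1)) ^ d, fun d => ?_⟩
    refine iSup₂_le fun H hH => EReal.coe_le_coe_iff.2 ?_
    obtain ⟨G, hG, hminor⟩ := hH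
    obtain ⟨_, E, hE, hadj⟩ := ((G.stackNumber_le_iff k).1 (hk G hG)).exists_pages
    refine StackExpansion.FinGraph.density_le (by positivity) ?_
    beta_reduce
    exact_mod_cast hminor.ncard_edgeSet_le E hE hadj
  · intro k hk G hG r
    refine iSup₂_le fun H hH => EReal.coe_le_coe_iff.2 ?_
    obtain ⟨_, rfl, S, hS⟩ := hH
    obtain ⟨_, E, hE, hadj⟩ := hG.exists_pages
    refine le_trans (StackExpansion.FinGraph.density_le (by positivity) ?_)
      (StackExpansion.growth_le hk r)
    -- The subdivision is all of `S.coe`, so the order and the pages of `G` are restricted to `S`.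
    exact_mod_cast StackExpansion.IsSubdivision.ncard_edgeSet_le (G := S.coe)
      (fun c u v => E c u v)
      (fun c => ⟨fun u v => (hE c).symm u v, fun u v u' v' => (hE c).noncrossing u v u' v'⟩)
      (fun u v h => hadj u v (S.adj_sub h)) hS
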